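/- All $C^*$-algebras are unital, and embeddings are unital injective $*$-homomorphisms. A map $f:A\to B$ between $C^*$-algebras is \emph{nuclear} if for every finite $F\subseteq A$ and every $\varepsilon>0$ there are $k$ and completely positive contractions $\phi:A\to M_k(\mathbb C)$ and $\psi:M_k(\mathbb C)\to B$ with $\|\psi(\phi(a))-f(a)\|<\varepsilon$ for all $a\in F$. $A$ is \emph{nuclear} if $\mathrm{id}_A$ is nuclear, and \emph{exact} if it has a faithful representation $\pi:A\to\mathcal B(H)$ on a Hilbert space that is nuclear as a map into $\mathcal B(H)$. An embedding $f:A\to B$ is \emph{existential} (in the language of unital $C^*$-algebras) if for every quantifier-free formula $\varphi(v,w)$ of continuous logic in that language, every integer $N\ge 1$ and every tuple $a$ from $A$, $$\inf\{\varphi(a,b) : b\in A_{\le N}\}=\inf\{\varphi(f(a),c) : c\in B_{\le N}\},$$ where $b,c$ range over tuples from the ball of radius $N$. Here atomic formulae are distances between terms built from variables, $0$, $1$, addition, multiplication, scalar multiplication and adjoint, and connectives are the continuous functions $\mathbb R^k\to\mathbb R$. $A$ is \emph{existentially closed} if every embedding of $A$ into a $C^*$-algebra is existential. $f$ is \emph{existential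 in the language of operator systems} if the same equality (with the induced maps on all sorts) holds for quantifier-free formulae of the following many-sorted language. For $m,n\ge 1$ the sorts are $M_n(S)$ with the operator norm, the positive cones $\mathcal C_n\subseteq M_n(S)$, the scalar matrices $M_{m,n}(\mathbb C)$ with the operator norm, and $\mathbb R^{\ge 0}$, where $S$ is the given $C^*$-algebra; tuples are quantified over the elements of norm at most $N$ of the respective sorts. The symbols are: $0,1\in S=M_1(S)$; on $M_n(S)$ addition, adjoint, multiplication by scalars, $(\alpha,X)\mapsto\alpha^*X\alpha$ for $\alpha\in M_{m,n}(\mathbb C)$, $X\in M_m(S)$, the map $X\mapsto\begin{pmatrix}1&X\\X^*&1\end{pmatrix}\in M_{2n}(S)$, the entry maps $M_n(S)\to S$, and the norm; on $\mathcal C_n$ addition, multiplication by nonnegative reals, $(\alpha,X)\mapsto\alpha^*X\alpha$, and the inclusion $\mathcal C_n\to M_n(S)$; on scalar matrices entries, addition, multiplication, adjoint and the constants $1,i\in\mathbb C$; and the metric of each sort. \textbf{Theorem.} \begin{enumerate} \item If $f:A\to B$ is a nuclear existential embedding (in the language of unital $C^*$-algebras), then $A$ is nuclear. \item If $f:A\to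 B$ is a nuclear embedding of $C^*$-algebras that is existential in the language of operator systems, then $A$ is nuclear. \item If $A$ is an exact existentially closed $C^*$-algebra, then $A$ is nuclear. \end{enumerate} -/

import Mathlib

open scoped NNReal ComplexOrder CStarAlgebra

universe u v

noncomputable section

/-! ## Nuclear maps, nuclear algebras, exact algebras -/

/-- A map `f : A → B` between unital C⋆-algebras is nuclear if it is a point-norm limit of maps
that factor through full matrix algebras by completely positive contractions
`A → M_k(ℂ) → B`. -/
def IsNuclearMap {A : Type u} {B : Type v}
    [CStarAlgebra A] [PartialOrder A] [StarOrderedRing A]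
    [CStarAlgebra B] [PartialOrder B] [StarOrderedRing B] (f : A → B) : Prop :=
  ∀ (F : Finset A) (ε : ℝ), 0 < ε →
    ∃ (k : ℕ) (φ : A →CP CStarMatrix (Fin k) (Fin k) ℂ) (ψ : CStarMatrix (Fin k) (Fin k) ℂ →CP B),
      (∀ a, ‖φ a‖ ≤ ‖a‖) ∧ (∀ x, ‖ψ x‖ ≤ ‖x‖) ∧ ∀ a ∈ F, ‖ψ (φ a) - f a‖ < ε

/-- A unital C⋆-algebra is nuclear if its identity map is nuclear. -/
def IsNuclearCStar (A : Type u) [CStarAlgebra A] [PartialOrder A] [StarOrderedRing A] : Prop :=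
  IsNuclearMap (fun a : A => a)

/-- A unital C⋆-algebra is exact if it has a faithful (unital) representation on a Hilbert space
that is nuclear as a map into the algebra of all bounded operators. -/
def IsExactCStar (A : Type u) [CStarAlgebra A] [PartialOrder A] [StarOrderedRing A] : Prop :=
  ∃ (H : Type u) (_ : NormedAddCommGroup H) (_ : InnerProductSpace ℂ H) (_ : CompleteSpace H)
    (π : A →⋆ₐ[ℂ] (H →L[ℂ] H)), Function.Injective π ∧ IsNuclearMap (fun a : A => π a)

/-! ## The language of unital C⋆-algebras -/

namespace CStarLogic

/-- Terms of the language of unital C⋆-algebras in the variables `V`. -/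
inductive Term (V : Type) : Type
  | var (x : V) : Term V
  | zero : Term V
  | one : Term V
  | add (s t : Term V) : Term V
  | mul (s t : Term V) : Term V
  | smul (c : ℂ) (t : Term V) : Term V
  | adj (t : Term V) : Term V

/-- Quantifier-free formulae of continuous logic in the language of unital C⋆-algebras: atomic
formulae are distances between terms, connectives are the continuous functions `ℝᵏ → ℝ`. -/
inductive QFFormula (V : Type) : Type
  | dist (s t : Term V) : QFFormula V
  | conn (k : ℕ) (g : C(Fin k → ℝ, ℝ)) (φ : Fin k → QFFormula V) : QFFormula V

variable {V : Type} {A : Type u} [CStarAlgebra A]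

/-- The value of a term under an assignment of its variables. -/
def Term.eval (a : V → A) : Term V → A
  | .var x => a x
  | .zero => 0
  | .one => 1
  | .add s t => s.eval a + t.eval a
  | .mul s t => s.eval a * t.eval a
  | .smul c t => c • t.eval a
  | .adj t => star (t.eval a)

/-- The value of a quantifier-free formula under an assignment of its variables. -/
def QFFormula.eval (a : V → A) : QFFormula V → ℝ
  | .dist s t => ‖s.eval a - t.eval a‖
  | .conn _ g φ => g fun i => (φ i).eval a

/-- `inf {φ(a, b) : b a tuple from the ball of radius N}`. -/
def infBall {p q : ℕ} (φ : QFFormula (Fin p ⊕ Fin q)) (N : ℕ) (a : Fin p → A) : ℝ :=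
  sInf {r : ℝ | ∃ b : Fin q → A, (∀ j, ‖b j‖ ≤ N) ∧ r = φ.eval (Sum.elim a b)}

/-- Existential embeddings in the language of unital C⋆-algebras. -/
def IsExistential {B : Type v} [CStarAlgebra B] (f : A →⋆ₐ[ℂ] B) : Prop :=
  Function.Injective f ∧
    ∀ (p q : ℕ) (φ : QFFormula (Fin p ⊕ Fin q)) (N : ℕ), 1 ≤ N → ∀ a : Fin p → A,
      infBall φ N a = infBall φ N (fun i => f (a i))

variable (A) in
/-- `A` is existentially closed: all its unital embeddings into unital C⋆-algebras are
existential. -/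
def IsExistentiallyClosed : Prop :=
  ∀ (B : Type u) [CStarAlgebra B] (f : A →⋆ₐ[ℂ] B), Function.Injective f → IsExistential f

end CStarLogic

/-! ## The language of operator systems -/

namespace OpSysLogic

/-- The sorts of the language of operator systems. -/
inductive Srt : Type
  /-- `M_n(S)`; the operator system `S` itself is `M_1(S)` -/
  | mat (n : ℕ+) : Srt
  /-- the cone of positive elements of `M_n(S)` -/
  | cone (n : ℕ+) : Srt
  /-- `M_{m,n}(ℂ)`; the scalars `ℂ` are `M_{1,1}(ℂ)` -/
  | scal (m n : ℕ+) : Srt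
  /-- the nonnegative reals -/
  | nonneg : Srt

/-- Terms of the language of operator systems, in variables `V` with sorts given by `s`. -/
inductive Term {V : Type} (s : V → Srt) : Srt → Type
  | var (x : V) : Term s (s x)
  | zero : Term s (.mat 1)
  | one : Term s (.mat 1)
  | add {n : ℕ+} (X Y : Term s (.mat n)) : Term s (.mat n)
  | adj {n : ℕ+} (X : Term s (.mat n)) : Term s (.mat n)
  | smul {n : ℕ+} (c : Term s (.scal 1 1)) (X : Term s (.mat n)) : Term s (.mat n)
  /-- `(α, X) ↦ α⋆ X α` -/
  | conj {m n : ℕ+} (α : Term s (.scal m n)) (X : Term s (.mat m)) : Term s (.mat n)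
  | coneAdd {n : ℕ+} (X Y : Term s (.cone n)) : Term s (.cone n)
  | coneSMul {n : ℕ+} (r : Term s .nonneg) (X : Term s (.cone n)) : Term s (.cone n)
  /-- `(α, X) ↦ α⋆ X α` -/
  | coneConj {m n : ℕ+} (α : Term s (.scal m n)) (X : Term s (.cone m)) : Term s (.cone n)
  /-- the inclusion of the cone into `M_n(S)` -/
  | incl {n : ℕ+} (X : Term s (.cone n)) : Term s (.mat n)
  /-- `X ↦ [[1, X], [X⋆, 1]]` -/
  | block {n : ℕ+} (X : Term s (.mat n)) : Term s (.mat (n + n))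
  | entry {n : ℕ+} (i j : Fin n) (X : Term s (.mat n)) : Term s (.mat 1)
  | scalEntry {m n : ℕ+} (i : Fin m) (j : Fin n) (α : Term s (.scal m n)) : Term s (.scal 1 1)
  | scalAdd {m n : ℕ+} (α β : Term s (.scal m n)) : Term s (.scal m n)
  | scalMul {l m n : ℕ+} (α : Term s (.scal l m)) (β : Term s (.scal m n)) : Term s (.scal l n)
  | scalAdj {m n : ℕ+} (α : Term s (.scal m n)) : Term s (.scal n m)
  | scalOne : Term s (.scal 1 1)
  | scalI : Term s (.scal 1 1)

/-- Quantifier-free formulae of continuous logic in the language of operator systems. -/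
inductive QFFormula {V : Type} (s : V → Srt) : Type
  | norm {n : ℕ+} (X : Term s (.mat n)) : QFFormula s
  | dist {σ : Srt} (t t' : Term s σ) : QFFormula s
  | conn (k : ℕ) (g : C(Fin k → ℝ, ℝ)) (φ : Fin k → QFFormula s) : QFFormula s

theorem exists_eq_star_mul_self {D : Type u} [NonUnitalCStarAlgebra D] [PartialOrder D]
    [StarOrderedRing D] {x : D} (h : 0 ≤ x) : ∃ y, x = star y * y :=
  CStarAlgebra.nonneg_iff_eq_star_mul_self.mp h

section Matrices

variable {A : Type u} [CStarAlgebra A]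

/-- `α⋆ X α` for a scalar matrix `α` and a matrix `X` over `A`. -/
def conjMat {m n : ℕ} (α : CStarMatrix (Fin m) (Fin n) ℂ) (X : CStarMatrix (Fin m) (Fin m) A) :
    CStarMatrix (Fin n) (Fin n) A :=
  CStarMatrix.ofMatrix fun i j => ∑ k, ∑ l, (star (α k i) * α l j) • X k l

/-- `[[1, X], [X⋆, 1]]`. -/
def blockMat {n : ℕ} (X : CStarMatrix (Fin n) (Fin n) A) :
    CStarMatrix (Fin (n + n)) (Fin (n + n)) A :=
  CStarMatrix.ofMatrix <| Matrix.reindex finSumFinEquiv finSumFinEquiv <|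
    Matrix.fromBlocks (1 : Matrix (Fin n) (Fin n) A) (CStarMatrix.ofMatrix.symm X)
      (CStarMatrix.ofMatrix.symm (star X)) 1

theorem conjMat_apply {m n : ℕ} (α : CStarMatrix (Fin m) (Fin n) ℂ)
    (X : CStarMatrix (Fin m) (Fin m) A) (i j : Fin n) :
    conjMat α X i j = ∑ k, ∑ l, (star (α k i) * α l j) • X k l := rfl

/-- An auxiliary matrix whose first row is the `p`-th row of `Y α`, all other entries zero. -/
def rowMat {m n : ℕ} (α : CStarMatrix (Fin m) (Fin (n + 1)) ℂ)
    (Y : CStarMatrix (Fin m) (Fin m) A) (p : Fin m) :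
    CStarMatrix (Fin (n + 1)) (Fin (n + 1)) A :=
  CStarMatrix.ofMatrix fun i j => if i = 0 then ∑ l, α l j • Y p l else 0

theorem rowMat_apply {m n : ℕ} (α : CStarMatrix (Fin m) (Fin (n + 1)) ℂ)
    (Y : CStarMatrix (Fin m) (Fin m) A) (p : Fin m) (i j : Fin (n + 1)) :
    rowMat α Y p i j = if i = 0 then ∑ l, α l j • Y p l else 0 := rfl

theorem matSum_apply {n m : ℕ} (R : Fin m → CStarMatrix (Fin n) (Fin n) A) (i j : Fin n) :
    (∑ p, R p) i j = ∑ p, R p i j :=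
  Matrix.sum_apply i j Finset.univ fun p => CStarMatrix.ofMatrix.symm (R p)

end Matrices

section Structure

variable {A : Type u} [CStarAlgebra A] [PartialOrder A] [StarOrderedRing A]

theorem conjMat_nonneg {m n : ℕ} (α : CStarMatrix (Fin m) (Fin n) ℂ)
    {X : CStarMatrix (Fin m) (Fin m) A} (hX : 0 ≤ X) : 0 ≤ conjMat α X := by
  obtain ⟨Y, rfl⟩ := exists_eq_star_mul_self hX
  rcases n with _ | n
  · exact le_of_eq (by ext i; exact i.elim0)
  have h : conjMat α (star Y * Y) = ∑ p, star (rowMat α Y p) * rowMat α Y p := by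
    ext i j
    rw [matSum_apply, conjMat_apply]
    simp only [CStarMatrix.mul_apply, CStarMatrix.star_apply, rowMat_apply]
    simp only [ite_mul, mul_ite, apply_ite star, star_zero, zero_mul, mul_zero,
      Finset.sum_ite_eq', Finset.mem_univ, if_true]
    simp only [star_sum, star_smul, Finset.sum_mul, Finset.mul_sum, smul_mul_smul_comm,
      Finset.smul_sum]
    rw [Finset.sum_comm, Finset.sum_congr rfl fun _ _ => Finset.sum_comm, Finset.sum_comm]
  rw [h]
  exact Finset.sum_nonneg fun p _ => star_mul_self_nonneg _

theorem smul_mat_nonneg {n : ℕ} (r : ℝ≥0) {X : CStarMatrix (Fin n) (Fin n) A} (hX : 0 ≤ X) :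
    0 ≤ ((r : ℝ) : ℂ) • X :=
  smul_nonneg (by simp) hX

theorem map_mat_nonneg {B : Type v} [CStarAlgebra B] [PartialOrder B] [StarOrderedRing B]
    (f : A →⋆ₐ[ℂ] B) {n : ℕ} {X : CStarMatrix (Fin n) (Fin n) A} (hX : 0 ≤ X) :
    0 ≤ X.map f :=
  CompletelyPositiveMapClass.map_cstarMatrix_nonneg' f n X hX

variable (A) in
/-- The interpretation of the sorts in a unital C⋆-algebra, viewed as an operator system. -/
abbrev Carrier : Srt → Type u
  | .mat n => CStarMatrix (Fin n) (Fin n) A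
  | .cone n => {X : CStarMatrix (Fin n) (Fin n) A // 0 ≤ X}
  | .scal m n => ULift.{u} (CStarMatrix (Fin m) (Fin n) ℂ)
  | .nonneg => ULift.{u} ℝ≥0

/-- The metric of each sort. -/
def carrierDist : (σ : Srt) → Carrier A σ → Carrier A σ → ℝ
  | .mat n => fun (X Y : CStarMatrix (Fin n) (Fin n) A) => ‖X - Y‖
  | .cone n => fun (X Y : {X : CStarMatrix (Fin n) (Fin n) A // 0 ≤ X}) => ‖X.1 - Y.1‖
  | .scal m n => fun (α β : ULift.{u} (CStarMatrix (Fin m) (Fin n) ℂ)) => ‖α.down - β.down‖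
  | .nonneg => fun (r t : ULift.{u} ℝ≥0) => dist r.down t.down

/-- The norm that cuts out the domains of quantification of each sort. -/
def carrierNorm : (σ : Srt) → Carrier A σ → ℝ
  | .mat n => fun (X : CStarMatrix (Fin n) (Fin n) A) => ‖X‖
  | .cone n => fun (X : {X : CStarMatrix (Fin n) (Fin n) A // 0 ≤ X}) => ‖X.1‖
  | .scal m n => fun (α : ULift.{u} (CStarMatrix (Fin m) (Fin n) ℂ)) => ‖α.down‖
  | .nonneg => fun (r : ULift.{u} ℝ≥0) => (r.down : ℝ)

/-- The map induced on each sort by a unital ⋆-homomorphism. -/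
def carrierMap {B : Type v} [CStarAlgebra B] [PartialOrder B] [StarOrderedRing B]
    (f : A →⋆ₐ[ℂ] B) : (σ : Srt) → Carrier A σ → Carrier B σ
  | .mat n => fun (X : CStarMatrix (Fin n) (Fin n) A) => (X.map f : CStarMatrix _ _ B)
  | .cone n => fun (X : {X : CStarMatrix (Fin n) (Fin n) A // 0 ≤ X}) =>
      (⟨X.1.map f, map_mat_nonneg f X.2⟩ : {X : CStarMatrix (Fin n) (Fin n) B // 0 ≤ X})
  | .scal m n => fun (α : ULift.{u} (CStarMatrix (Fin m) (Fin n) ℂ)) => ULift.up α.down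
  | .nonneg => fun (r : ULift.{u} ℝ≥0) => ULift.up r.down

/-- The value of a term under an assignment of its variables. -/
def Term.eval {V : Type} {s : V → Srt} (a : (x : V) → Carrier A (s x)) :
    {σ : Srt} → Term s σ → Carrier A σ
  | _, .var x => a x
  | _, .zero => (0 : CStarMatrix (Fin 1) (Fin 1) A)
  | _, .one => (1 : CStarMatrix (Fin 1) (Fin 1) A)
  | _, .add (n := n) X Y =>
      let X' : CStarMatrix (Fin n) (Fin n) A := X.eval a
      let Y' : CStarMatrix (Fin n) (Fin n) A := Y.eval a
      X' + Y'
  | _, .adj (n := n) X => (star (X.eval a) : CStarMatrix (Fin n) (Fin n) A)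
  | _, .smul (n := n) c X =>
      let c' : ULift.{u} (CStarMatrix (Fin 1) (Fin 1) ℂ) := c.eval a
      let X' : CStarMatrix (Fin n) (Fin n) A := X.eval a
      c'.down 0 0 • X'
  | _, .conj α X => conjMat (ULift.down (α.eval a)) (X.eval a)
  | _, .coneAdd (n := n) X Y =>
      let X' : {X : CStarMatrix (Fin n) (Fin n) A // 0 ≤ X} := X.eval a
      let Y' : {X : CStarMatrix (Fin n) (Fin n) A // 0 ≤ X} := Y.eval a
      (⟨X'.1 + Y'.1, add_nonneg X'.2 Y'.2⟩ : {X : CStarMatrix (Fin n) (Fin n) A // 0 ≤ X})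
  | _, .coneSMul (n := n) r X =>
      let r' : ULift.{u} ℝ≥0 := r.eval a
      let X' : {X : CStarMatrix (Fin n) (Fin n) A // 0 ≤ X} := X.eval a
      (⟨((r'.down : ℝ) : ℂ) • X'.1, smul_mat_nonneg r'.down X'.2⟩ :
        {X : CStarMatrix (Fin n) (Fin n) A // 0 ≤ X})
  | _, .coneConj (m := m) (n := n) α X =>
      let α' : ULift.{u} (CStarMatrix (Fin m) (Fin n) ℂ) := α.eval a
      let X' : {X : CStarMatrix (Fin m) (Fin m) A // 0 ≤ X} := X.eval a
      (⟨conjMat α'.down X'.1, conjMat_nonneg α'.down X'.2⟩ :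
        {X : CStarMatrix (Fin n) (Fin n) A // 0 ≤ X})
  | _, .incl (n := n) X => (X.eval a : {X : CStarMatrix (Fin n) (Fin n) A // 0 ≤ X}).1
  | _, .block (n := n) X => blockMat (n := (n : ℕ)) (X.eval a)
  | _, .entry (n := n) i j X =>
      (CStarMatrix.ofMatrix fun _ _ => (X.eval a : CStarMatrix (Fin n) (Fin n) A) i j :
        CStarMatrix (Fin 1) (Fin 1) A)
  | _, .scalEntry (m := m) (n := n) i j α =>
      (⟨CStarMatrix.ofMatrix fun _ _ =>
        (α.eval a : ULift.{u} (CStarMatrix (Fin m) (Fin n) ℂ)).down i j⟩ :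
          ULift.{u} (CStarMatrix (Fin 1) (Fin 1) ℂ))
  | _, .scalAdd (m := m) (n := n) α β =>
      (⟨(α.eval a : ULift.{u} (CStarMatrix (Fin m) (Fin n) ℂ)).down +
        (β.eval a : ULift.{u} (CStarMatrix (Fin m) (Fin n) ℂ)).down⟩ :
          ULift.{u} (CStarMatrix (Fin m) (Fin n) ℂ))
  | _, .scalMul (l := l) (m := m) (n := n) α β =>
      (⟨(α.eval a : ULift.{u} (CStarMatrix (Fin l) (Fin m) ℂ)).down *
        (β.eval a : ULift.{u} (CStarMatrix (Fin m) (Fin n) ℂ)).down⟩ :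
          ULift.{u} (CStarMatrix (Fin l) (Fin n) ℂ))
  | _, .scalAdj (m := m) (n := n) α =>
      (⟨(α.eval a : ULift.{u} (CStarMatrix (Fin m) (Fin n) ℂ)).down.conjTranspose⟩ :
          ULift.{u} (CStarMatrix (Fin n) (Fin m) ℂ))
  | _, .scalOne => (⟨1⟩ : ULift.{u} (CStarMatrix (Fin 1) (Fin 1) ℂ))
  | _, .scalI => (⟨Complex.I • 1⟩ : ULift.{u} (CStarMatrix (Fin 1) (Fin 1) ℂ))

/-- The value of a quantifier-free formula under an assignment of its variables. -/
def QFFormula.eval {V : Type} {s : V → Srt} (a : (x : V) → Carrier A (s x)) : QFFormula s → ℝ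
  | .norm X => carrierNorm _ (X.eval a)
  | .dist t t' => carrierDist _ (t.eval a) (t'.eval a)
  | .conn _ g φ => g fun i => (φ i).eval a

/-- `inf {φ(a, b) : b a tuple (of the right sorts) from the domains of radius N}`. -/
def infBall {p q : ℕ} {s : Fin p → Srt} {t : Fin q → Srt} (φ : QFFormula (Sum.elim s t)) (N : ℕ)
    (a : (i : Fin p) → Carrier A (s i)) : ℝ :=
  sInf {r : ℝ | ∃ b : (j : Fin q) → Carrier A (t j), (∀ j, carrierNorm _ (b j) ≤ N) ∧
    r = φ.eval (Sum.rec a b)}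

/-- Embeddings of unital C⋆-algebras that are existential in the language of operator systems. -/
def IsExistential {B : Type v} [CStarAlgebra B] [PartialOrder B] [StarOrderedRing B]
    (f : A →⋆ₐ[ℂ] B) : Prop :=
  Function.Injective f ∧
    ∀ (p q : ℕ) (s : Fin p → Srt) (t : Fin q → Srt) (φ : QFFormula (Sum.elim s t)) (N : ℕ), 1 ≤ N →
      ∀ a : (i : Fin p) → Carrier A (s i),
        infBall φ N a = infBall φ N (fun i => carrierMap f _ (a i))

end Structure

end OpSysLogic

end

/-!
A completely positive map `ψ : M_k(ℂ) → B` is the same thing as a positive matrix over `B`, its Choi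
matrix `C = (ψ e_ij)_ij`: one has `ψ x = ∑ i j, x i j • C i j`, the map is completely positive exactly
when `C ≥ 0` (`choiMatrix_nonneg`, `choiMap_map_nonneg`), and its norm is at most that of
`ψ 1 = ∑ i, C i i` (`norm_choiMap_le`). So, once the first half `φ : A → M_k(ℂ)` of an approximate
factorization of `f : A → B` is fixed, the existence of the second half is a system of approximate
conditions on a positive matrix over `B` whose parameters are elements of `A` and complex numbers:
`‖∑ i, C i i‖ ≤ 1` and `‖∑ i j, (φ a) i j • C i j - f a‖ ≤ ε` for finitely many `a`.

Both languages can express this system. In the language of operator systems one quantifies over the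
cone of positive matrices; in the language of C⋆-algebras one quantifies over the entries of a matrix
`Y` with `C = Y⋆ Y`. If `f` is existential, the system therefore has approximate solutions over `A`
itself (the two lemmas named `IsExistential.liftsPositiveMatrices`), and after a small rescaling these
give the second half of an approximate factorization of the identity of `A`
(`LiftsPositiveMatrices.isNuclearCStar`). A faithful representation of an existentially closed algebra
on a Hilbert space is an existential embedding, so the statement on exact algebras is a special case.
-/

noncomputable section

namespace ChoiCorrespondence

/-! ### Choi matrices of completely positive maps on matrix algebras -/

section Algebra

variable {A : Type u} [CStarAlgebra A]

theorem sum_comm₄ {α β γ δ M : Type*} [Fintype α] [Fintype β] [Fintype γ] [Fintype δ]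
    [AddCommMonoid M] (f : α → β → γ → δ → M) :
    ∑ a, ∑ b, ∑ c, ∑ d, f a b c d = ∑ d, ∑ c, ∑ b, ∑ a, f a b c d := by
  have h₃ (g : β → γ → δ → M) : ∑ b, ∑ c, ∑ d, g b c d = ∑ d, ∑ c, ∑ b, g b c d := by
    rw [Finset.sum_comm, Finset.sum_congr rfl fun _ _ => Finset.sum_comm, Finset.sum_comm]
  rw [Finset.sum_congr rfl fun a _ => h₃ (f a), Finset.sum_comm]
  refine Finset.sum_congr rfl fun d _ => ?_
  rw [Finset.sum_comm]
  exact Finset.sum_congr rfl fun c _ => Finset.sum_comm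

/-- The linear map `M_k(ℂ) → A` with Choi matrix `C`: it sends the matrix unit `e_ij` to `C i j`. -/
def choiMap {k : ℕ} (C : CStarMatrix (Fin k) (Fin k) A) :
    CStarMatrix (Fin k) (Fin k) ℂ →ₗ[ℂ] A where
  toFun x := ∑ i, ∑ j, x i j • C i j
  map_add' x y := by simp [add_smul, Finset.sum_add_distrib]
  map_smul' c x := by simp [Finset.smul_sum, mul_smul]

theorem choiMap_apply {k : ℕ} (C : CStarMatrix (Fin k) (Fin k) A)
    (x : CStarMatrix (Fin k) (Fin k) ℂ) : choiMap C x = ∑ i, ∑ j, x i j • C i j := rfl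

theorem choiMap_one {k : ℕ} (C : CStarMatrix (Fin k) (Fin k) A) : choiMap C 1 = ∑ i, C i i := by
  simp [choiMap_apply, CStarMatrix.one_apply, ite_smul]

/-- The column obtained by letting a scalar matrix `x` act on each row of `Y`, read as a vector: its
entry at `(s, l)` is `∑ j, x s j • Y l j`. These columns give a Kraus decomposition of the map with
Choi matrix `Y⋆ Y`. -/
def krausVec {k : ℕ} (Y : CStarMatrix (Fin k) (Fin k) A) (x : CStarMatrix (Fin k) (Fin k) ℂ)
    (t : Fin k × Fin k) : A :=
  ∑ j, x t.1 j • Y t.2 j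

theorem choiMap_star_mul {k : ℕ} (Y : CStarMatrix (Fin k) (Fin k) A)
    (x y : CStarMatrix (Fin k) (Fin k) ℂ) :
    choiMap (star Y * Y) (star x * y) = ∑ t, star (krausVec Y x t) * krausVec Y y t := by
  simp only [choiMap_apply, krausVec, CStarMatrix.mul_apply, CStarMatrix.star_apply,
    Fintype.sum_prod_type, star_sum, star_smul, Finset.sum_mul, Finset.mul_sum,
    smul_mul_smul_comm, Finset.sum_smul, Finset.smul_sum]
  exact sum_comm₄ fun i j l s => (star (x s i) * y s j) • (star (Y l i) * Y l j)

end Algebra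

section Order

variable {A : Type u} [CStarAlgebra A] [PartialOrder A] [StarOrderedRing A]

/-- A Gram matrix over a C⋆-algebra is positive, being a sum of matrices `R⋆ R` where `R` has a single
nonzero row. -/
theorem gram_nonneg {ι : Type*} [Fintype ι] {n : ℕ} (w : ι → Fin n → A) :
    0 ≤ (CStarMatrix.ofMatrix fun p q => ∑ t, star (w t p) * w t q :
      CStarMatrix (Fin n) (Fin n) A) := by
  rcases n with _ | n
  · exact le_of_eq (by ext i; exact i.elim0)
  let R (t : ι) : CStarMatrix (Fin (n + 1)) (Fin (n + 1)) A :=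
    CStarMatrix.ofMatrix fun i j => if i = 0 then w t j else 0
  have hR (t : ι) (i j) : R t i j = if i = 0 then w t j else 0 := rfl
  have h : (CStarMatrix.ofMatrix fun p q => ∑ t, star (w t p) * w t q :
      CStarMatrix (Fin (n + 1)) (Fin (n + 1)) A) = ∑ t, star (R t) * R t := by
    ext p q
    rw [show (∑ t, star (R t) * R t) p q = ∑ t, (star (R t) * R t) p q from
      Matrix.sum_apply p q Finset.univ fun t => CStarMatrix.ofMatrix.symm (star (R t) * R t)]
    simp only [CStarMatrix.mul_apply, CStarMatrix.star_apply, hR]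
    simp
    rfl
  rw [h]
  exact Finset.sum_nonneg fun t _ => star_mul_self_nonneg _

open WithCStarModule in
/-- The Cauchy–Schwarz inequality in the Hilbert module `A^ι`. -/
theorem norm_sum_star_mul_sq_le {ι : Type*} [Fintype ι] (v w : ι → A) :
    ‖∑ t, star (v t) * w t‖ ^ 2 ≤ ‖∑ t, star (v t) * v t‖ * ‖∑ t, star (w t) * w t‖ := by
  -- The inner product of `C⋆ᵐᵒᵈ(A, ι → A)` is `⟪x, y⟫ = ∑ t, y t * star (x t)`.
  have key := CStarModule.norm_inner_le (A := A) C⋆ᵐᵒᵈ(A, ι → A)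
    (x := (equiv A (ι → A)).symm fun t => star (w t))
    (y := (equiv A (ι → A)).symm fun t => star (v t))
  have h := pow_le_pow_left₀ (norm_nonneg _) key 2
  rw [mul_pow, pi_norm_sq, pi_norm_sq] at h
  simpa [pi_inner, inner_def, mul_comm] using h

/-- The easy half of Choi's theorem: a positive Choi matrix gives a completely positive map, since
the Kraus decomposition turns `(star N * N).map (choiMap C)` into a Gram matrix. -/
theorem choiMap_map_nonneg {k : ℕ} {C : CStarMatrix (Fin k) (Fin k) A} (hC : 0 ≤ C) (n : ℕ)
    (M : CStarMatrix (Fin n) (Fin n) (CStarMatrix (Fin k) (Fin k) ℂ)) (hM : 0 ≤ M) :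
    0 ≤ M.map (choiMap C) := by
  obtain ⟨Y, rfl⟩ := OpSysLogic.exists_eq_star_mul_self hC
  obtain ⟨N, rfl⟩ := OpSysLogic.exists_eq_star_mul_self hM
  convert gram_nonneg (ι := Fin n × (Fin k × Fin k)) fun t p => krausVec Y (N t.1 p) t.2 using 1
  ext p q
  simp only [CStarMatrix.map_apply, CStarMatrix.mul_apply, CStarMatrix.star_apply, map_sum,
    choiMap_star_mul, Fintype.sum_prod_type]
  rfl

/-- The completely positive map with a given positive Choi matrix. -/
def choiCP {k : ℕ} (C : CStarMatrix (Fin k) (Fin k) A) (hC : 0 ≤ C) :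
    CStarMatrix (Fin k) (Fin k) ℂ →CP A :=
  { choiMap C with map_cstarMatrix_nonneg' := choiMap_map_nonneg hC }

theorem choiCP_apply {k : ℕ} (C : CStarMatrix (Fin k) (Fin k) A) (hC : 0 ≤ C)
    (x : CStarMatrix (Fin k) (Fin k) ℂ) : choiCP C hC x = choiMap C x := rfl

theorem norm_map_star_mul_self_le {D : Type v} [CStarAlgebra D] [PartialOrder D]
    [StarOrderedRing D] (ψ : D →CP A) (x : D) : ‖ψ (star x * x)‖ ≤ ‖x‖ ^ 2 * ‖ψ 1‖ := by
  have hxx : star x * x ≤ ((‖x‖ ^ 2 : ℝ) : ℂ) • (1 : D) := by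
    have := IsSelfAdjoint.le_algebraMap_norm_self (a := star x * x) (.star_mul_self x)
    rwa [CStarRing.norm_star_mul_self, ← sq, Algebra.algebraMap_eq_smul_one,
      ← Complex.coe_smul] at this
  have hle := OrderHomClass.mono ψ hxx
  rw [map_smul] at hle
  refine (CStarAlgebra.norm_le_norm_of_nonneg_of_le
    (map_nonneg ψ (star_mul_self_nonneg x)) hle).trans ?_
  rw [norm_smul]
  simp

/-- The norm of a completely positive map on a matrix algebra is governed by its value at `1`, the
trace of its Choi matrix. With `C = Y⋆ Y`, Cauchy–Schwarz gives `‖ψ x‖² ≤ ‖ψ 1‖ ‖ψ (x⋆ x)‖`. -/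
theorem norm_choiMap_le {k : ℕ} {C : CStarMatrix (Fin k) (Fin k) A} (hC : 0 ≤ C)
    (x : CStarMatrix (Fin k) (Fin k) ℂ) : ‖choiMap C x‖ ≤ ‖∑ i, C i i‖ * ‖x‖ := by
  have hn : ‖choiMap C (star x * x)‖ ≤ ‖x‖ ^ 2 * ‖choiMap C 1‖ :=
    norm_map_star_mul_self_le (choiCP C hC) x
  rw [← choiMap_one]
  obtain ⟨Y, rfl⟩ := OpSysLogic.exists_eq_star_mul_self hC
  have h := norm_sum_star_mul_sq_le (krausVec Y 1) (krausVec Y x)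
  rw [← choiMap_star_mul, ← choiMap_star_mul, ← choiMap_star_mul, star_one, one_mul, one_mul] at h
  refine (sq_le_sq₀ (norm_nonneg _) (by positivity)).mp ?_
  calc _ ≤ _ := h
    _ ≤ ‖choiMap (star Y * Y) 1‖ * (‖x‖ ^ 2 * ‖choiMap (star Y * Y) 1‖) := by gcongr
    _ = _ := by ring

/-- The Choi matrix `(ψ e_ij)_ij` of a completely positive map on a matrix algebra. -/
def choiMatrix {k : ℕ} (ψ : CStarMatrix (Fin k) (Fin k) ℂ →CP A) :
    CStarMatrix (Fin k) (Fin k) A :=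
  CStarMatrix.ofMatrix fun i j => ψ (CStarMatrix.ofMatrix (Matrix.single i j 1))

theorem choiMatrix_nonneg {k : ℕ} (ψ : CStarMatrix (Fin k) (Fin k) ℂ →CP A) :
    0 ≤ choiMatrix ψ := by
  rcases k with _ | k
  · exact le_of_eq (by ext i; exact i.elim0)
  -- The matrix `(e_ij)_ij` over `M_k(ℂ)` is the Gram matrix of the matrix units `e_0j`.
  have h := gram_nonneg (A := CStarMatrix (Fin (k + 1)) (Fin (k + 1)) ℂ) (ι := Unit)
    fun _ p => CStarMatrix.ofMatrix (Matrix.single 0 p 1)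
  convert ψ.map_cstarMatrix_nonneg' _ _ h using 1
  ext p q
  change ψ _ = ψ (∑ _ : Unit, _)
  congr 1
  simp only [Finset.univ_unique, Finset.sum_singleton]
  have h1 : (Matrix.single 0 p (1 : ℂ) : Matrix (Fin (k + 1)) (Fin (k + 1)) ℂ).conjTranspose *
      Matrix.single 0 q 1 = Matrix.single p q 1 := by
    rw [Matrix.conjTranspose_single, star_one, Matrix.single_mul_single_same, mul_one]
  exact h1.symm

theorem choiMap_choiMatrix {k : ℕ} (ψ : CStarMatrix (Fin k) (Fin k) ℂ →CP A)
    (x : CStarMatrix (Fin k) (Fin k) ℂ) : choiMap (choiMatrix ψ) x = ψ x := by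
  have hx : x = ∑ i, ∑ j, x i j • CStarMatrix.ofMatrix (Matrix.single i j 1) := by
    refine (Matrix.matrix_eq_sum_single x).trans ?_
    refine Finset.sum_congr rfl fun i _ => Finset.sum_congr rfl fun j _ => ?_
    change _ = x i j • Matrix.single i j (1 : ℂ)
    simp
  calc choiMap (choiMatrix ψ) x
      = ∑ i, ∑ j, x i j • ψ (CStarMatrix.ofMatrix (Matrix.single i j 1)) := rfl
    _ = ψ (∑ i, ∑ j, x i j • CStarMatrix.ofMatrix (Matrix.single i j 1)) := by
      simp only [map_sum, map_smul]
    _ = ψ x := by rw [← hx]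

end Order

/-! ### Lifting positive matrices and nuclearity -/

/-- Approximate solvability in positive matrices `C` of the system `‖∑ i, C i i‖ ≤ 1`,
`∑ i j, (z r) i j • C i j = a r`, with scalar matrices `z r` and right-hand sides `a r ∈ A`, passes
from `B` to `A` along `f`, up to a change of the tolerance. The index set `Fin (p + 1)` is nonempty
because a sort `M_n(S)` of the language of operator systems has `n ≥ 1`. -/
def LiftsPositiveMatrices {A : Type u} [CStarAlgebra A] [PartialOrder A] [StarOrderedRing A]
    {B : Type v} [CStarAlgebra B] [PartialOrder B] [StarOrderedRing B] (f : A →⋆ₐ[ℂ] B) : Prop :=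
  ∀ (p k : ℕ) (a : Fin (p + 1) → A) (z : Fin (p + 1) → CStarMatrix (Fin k) (Fin k) ℂ) (ε : ℝ),
    0 < ε →
    (∃ C : CStarMatrix (Fin k) (Fin k) B, 0 ≤ C ∧ ‖∑ i, C i i‖ ≤ 1 ∧
      ∀ r, ‖choiMap C (z r) - f (a r)‖ ≤ ε) →
    ∃ C : CStarMatrix (Fin k) (Fin k) A, 0 ≤ C ∧ ‖∑ i, C i i‖ < 1 + ε ∧
      ∀ r, ‖choiMap C (z r) - a r‖ < ε + ε

theorem norm_one_le_one (D : Type*) [CStarAlgebra D] : ‖(1 : D)‖ ≤ 1 := by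
  rcases subsingleton_or_nontrivial D with _ | _
  · simp [Subsingleton.elim (1 : D) 0]
  · exact CStarRing.norm_one.le

/-- The half `M_k(ℂ) → B` of an approximate factorization of `f` is encoded by its positive Choi
matrix. Lifting that matrix to `A` and rescaling it gives the second half of a factorization of the
identity of `A`; the first half `A → M_k(ℂ)` is unchanged. -/
theorem LiftsPositiveMatrices.isNuclearCStar {A : Type u} [CStarAlgebra A] [PartialOrder A]
    [StarOrderedRing A] {B : Type v} [CStarAlgebra B] [PartialOrder B] [StarOrderedRing B]
    {f : A →⋆ₐ[ℂ] B} (hf : LiftsPositiveMatrices f) (hn : IsNuclearMap f) : IsNuclearCStar A := by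
  intro F ε hε
  set M : ℝ := ∑ a ∈ F, ‖a‖ with hM
  have hM0 : 0 ≤ M := Finset.sum_nonneg fun _ _ => norm_nonneg _
  have hMa : ∀ a ∈ F, ‖a‖ ≤ M := fun a ha =>
    Finset.single_le_sum (f := fun a : A => ‖a‖) (fun _ _ => norm_nonneg _) ha
  -- The error is `2 η` from the lifted system and at most `η M` from the rescaling by `(1 + η)⁻¹`.
  set η : ℝ := ε / (2 + M) with hη
  have hη0 : 0 < η := by positivity
  obtain ⟨k, φ, ψ, hφ, hψ, hF⟩ := hn F η hη0
  obtain ⟨p, e, he⟩ : ∃ (p : ℕ) (a : Fin (p + 1) → A), ↑F ⊆ Set.range a ∧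
      ∀ r, a r = 0 ∨ a r ∈ F := by
    refine ⟨F.card, Fin.cons 0 fun r => (F.equivFin.symm r : A), fun a ha =>
      ⟨Fin.succ (F.equivFin ⟨a, ha⟩), by simp⟩, fun r => ?_⟩
    refine Fin.cases ?_ (fun r => ?_) r <;> simp
  obtain ⟨C, hC, htr, hCa⟩ := hf p k e (fun r => φ (e r)) η hη0
    ⟨choiMatrix ψ, choiMatrix_nonneg ψ, by
      rw [← choiMap_one, choiMap_choiMatrix]
      exact (hψ 1).trans (norm_one_le_one _), fun r => by
      rw [choiMap_choiMatrix]
      rcases he.2 r with h | h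
      · simp [h, hη0.le]
      · exact (hF _ h).le⟩
  set c : ℝ := (1 + η)⁻¹ with hc
  have hc0 : 0 < c := by positivity
  have hc1 : c ≤ 1 := inv_le_one_of_one_le₀ (by linarith)
  have hcη : c * (1 + η) = 1 := inv_mul_cancel₀ (by positivity)
  have hcC : 0 ≤ (c : ℂ) • C := smul_nonneg (by exact_mod_cast hc0.le) hC
  have hsmul (x) : choiMap ((c : ℂ) • C) x = (c : ℂ) • choiMap C x := by
    simp only [choiMap_apply, CStarMatrix.smul_apply, Finset.smul_sum]
    exact Finset.sum_congr rfl fun i _ => Finset.sum_congr rfl fun j _ => smul_comm _ _ _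
  refine ⟨k, φ, choiCP _ hcC, hφ, fun x => ?_, fun a ha => ?_⟩
  · rw [choiCP_apply]
    refine (norm_choiMap_le hcC x).trans ?_
    refine mul_le_of_le_one_left (norm_nonneg _) ?_
    rw [← choiMap_one, hsmul, choiMap_one, norm_smul, Complex.norm_real, Real.norm_of_nonneg hc0.le,
      ← hcη]
    gcongr
  · obtain ⟨r, rfl⟩ := he.1 ha
    rw [choiCP_apply, hsmul]
    have h1 : (c : ℂ) • choiMap C (φ (e r)) - e r
        = (c : ℂ) • (choiMap C (φ (e r)) - e r) - ((1 - c : ℝ) : ℂ) • e r := by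
      push_cast
      module
    rw [h1]
    calc _ ≤ c * ‖choiMap C (φ (e r)) - e r‖ + (1 - c) * ‖e r‖ := by
          refine (norm_sub_le _ _).trans_eq ?_
          rw [norm_smul, norm_smul, Complex.norm_real, Complex.norm_real,
            Real.norm_of_nonneg hc0.le, Real.norm_of_nonneg (by linarith)]
      _ < (η + η) + η * M := by
          have h2 : c * ‖choiMap C (φ (e r)) - e r‖ < η + η :=
            (mul_le_of_le_one_left (norm_nonneg _) hc1).trans_lt (hCa r)
          have h3 : (1 - c) * ‖e r‖ ≤ η * M :=
            mul_le_mul (by nlinarith) (hMa _ ha) (norm_nonneg _) hη0.le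
          linarith
      _ = ε := by rw [hη]; field_simp; ring

end ChoiCorrespondence

/-! ### Conditions with thresholds as formulae -/

/-- The total amount by which the values `x i` exceed the thresholds `c i`, a connective that turns
a finite system of conditions `x i ≤ c i` into one formula. -/
def excess {n : ℕ} (c : Fin n → ℝ) : C(Fin n → ℝ, ℝ) where
  toFun x := ∑ i, max (x i - c i) 0

theorem excess_apply {n : ℕ} (c x : Fin n → ℝ) : excess c x = ∑ i, max (x i - c i) 0 := rfl

theorem excess_nonneg {n : ℕ} (c x : Fin n → ℝ) : 0 ≤ excess c x := by
  rw [excess_apply]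
  exact Finset.sum_nonneg fun _ _ => le_max_right _ _

theorem excess_eq_zero {n : ℕ} {c x : Fin n → ℝ} (h : ∀ i, x i ≤ c i) : excess c x = 0 := by
  rw [excess_apply]
  exact Finset.sum_eq_zero fun i _ => max_eq_right (sub_nonpos.mpr (h i))

theorem lt_add_of_excess_lt {n : ℕ} {c x : Fin n → ℝ} {δ : ℝ} (h : excess c x < δ) (i : Fin n) :
    x i < c i + δ := by
  have h1 : max (x i - c i) 0 ≤ excess c x := by
    rw [excess_apply]
    exact Finset.single_le_sum (f := fun i => max (x i - c i) 0) (fun _ _ => le_max_right _ _)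
      (Finset.mem_univ i)
  linarith [le_max_left (x i - c i) 0]

/-- If `0` is the least element of `T`, and `S` has the same infimum, then `S` has elements below any
positive number. -/
theorem exists_lt_of_sInf_eq {S T : Set ℝ} (h : sInf S = sInf T) (hS : S.Nonempty)
    (hT : ∀ r ∈ T, 0 ≤ r) (h0 : (0 : ℝ) ∈ T) {δ : ℝ} (hδ : 0 < δ) : ∃ r ∈ S, r < δ := by
  refine exists_lt_of_csInf_lt hS ?_
  rw [h, show sInf T = 0 from le_antisymm (csInf_le ⟨0, hT⟩ h0) (le_csInf ⟨0, h0⟩ hT)]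
  exact hδ

/-! ### The language of unital C⋆-algebras -/

namespace CStarLogic

/-- Along an existential embedding, a finite system of conditions `θ i ≤ c i` with parameters in `A`
that has a solution in `B` has approximate solutions in `A`. -/
theorem IsExistential.exists_lt {A : Type u} [CStarAlgebra A] {B : Type v} [CStarAlgebra B]
    {f : A →⋆ₐ[ℂ] B} (hf : IsExistential f) {n p q : ℕ} (θ : Fin n → QFFormula (Fin p ⊕ Fin q))
    (c : Fin n → ℝ) (a : Fin p → A) (b : Fin q → B)
    (hb : ∀ i, (θ i).eval (Sum.elim (fun i => f (a i)) b) ≤ c i) {δ : ℝ} (hδ : 0 < δ) :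
    ∃ b' : Fin q → A, ∀ i, (θ i).eval (Sum.elim a b') < c i + δ := by
  obtain ⟨N, hN1, hN⟩ : ∃ N : ℕ, 1 ≤ N ∧ ∀ j, ‖b j‖ ≤ N := by
    obtain ⟨N, hN⟩ := exists_nat_ge (∑ j, ‖b j‖)
    refine ⟨N + 1, by simp, fun j => ?_⟩
    have := Finset.single_le_sum (f := fun j => ‖b j‖) (fun _ _ => norm_nonneg _)
      (Finset.mem_univ j)
    push_cast
    linarith
  obtain ⟨_, ⟨b', -, rfl⟩, h⟩ := exists_lt_of_sInf_eq
    (hf.2 p q (.conn n (excess c) θ) N hN1 a) ⟨_, 0, by simp, rfl⟩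
    (by rintro _ ⟨d, -, rfl⟩; exact excess_nonneg _ _)
    ⟨b, hN, (excess_eq_zero hb).symm⟩ hδ
  exact ⟨b', lt_add_of_excess_lt h⟩

/-- The sum of a finite family of terms. -/
def Term.sum {V : Type} : {n : ℕ} → (Fin n → Term V) → Term V
  | 0, _ => .zero
  | _ + 1, t => .add (t 0) (Term.sum fun i => t i.succ)

theorem Term.eval_sum {V : Type} {A : Type u} [CStarAlgebra A] (a : V → A) {n : ℕ}
    (t : Fin n → Term V) : (Term.sum t).eval a = ∑ i, (t i).eval a := by
  induction n with
  | zero => rfl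
  | succ n ih =>
    rw [Fin.sum_univ_succ, ← ih]
    rfl

/-- The entries of a `k × k` matrix, listed as a tuple of length `k * k`. -/
def flatten {A : Type u} {k : ℕ} (Y : CStarMatrix (Fin k) (Fin k) A) (s : Fin (k * k)) : A :=
  Y (finProdFinEquiv.symm s).1 (finProdFinEquiv.symm s).2

theorem flatten_apply {A : Type u} {k : ℕ} (Y : CStarMatrix (Fin k) (Fin k) A) (i j : Fin k) :
    flatten Y (finProdFinEquiv (i, j)) = Y i j := by
  rw [flatten, Equiv.symm_apply_apply]

/-- The term for the `(i, j)` entry of `Y⋆ Y`, where the entries of `Y` are the last `k * k`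
variables. -/
def gramTerm {p k : ℕ} (i j : Fin k) : Term (Fin p ⊕ Fin (k * k)) :=
  Term.sum fun l => .mul (.adj (.var (.inr (finProdFinEquiv (l, i)))))
    (.var (.inr (finProdFinEquiv (l, j))))

theorem eval_gramTerm {A : Type u} [CStarAlgebra A] {p k : ℕ} (a : Fin p → A)
    (Y : CStarMatrix (Fin k) (Fin k) A) (i j : Fin k) :
    (gramTerm i j).eval (Sum.elim a (flatten Y)) =
      (star Y * Y) i j := by
  rw [gramTerm, Term.eval_sum, CStarMatrix.mul_apply]
  simp [Term.eval, CStarMatrix.star_apply, flatten_apply]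

open ChoiCorrespondence in
/-- Positivity of `C` is expressed in the language by writing `C = Y⋆ Y` and quantifying over the
entries of `Y`. -/
theorem IsExistential.liftsPositiveMatrices {A : Type u} [CStarAlgebra A] [PartialOrder A]
    [StarOrderedRing A] {B : Type v} [CStarAlgebra B] [PartialOrder B] [StarOrderedRing B]
    {f : A →⋆ₐ[ℂ] B} (hf : IsExistential f) : LiftsPositiveMatrices f := by
  rintro p k a z ε hε ⟨_, hC, htr, hCa⟩
  obtain ⟨Y, rfl⟩ := OpSysLogic.exists_eq_star_mul_self hC
  obtain ⟨b, hb⟩ := hf.exists_lt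
    (Fin.cons (.dist (Term.sum fun i => gramTerm i i) .zero) fun r =>
      .dist (Term.sum fun i => Term.sum fun j => .smul (z r i j) (gramTerm i j)) (.var (.inl r)))
    (Fin.cons 1 fun _ => ε) a
    (flatten Y)
    (by
      refine Fin.cases ?_ fun r => ?_
      · simpa [QFFormula.eval, Term.eval_sum, eval_gramTerm, Term.eval, choiMap_apply] using htr
      · simpa [QFFormula.eval, Term.eval_sum, eval_gramTerm, Term.eval, choiMap_apply] using hCa r) hε
  obtain ⟨Z, rfl⟩ : ∃ Z : CStarMatrix (Fin k) (Fin k) A, b = flatten Z :=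
    ⟨CStarMatrix.ofMatrix fun i j => b (finProdFinEquiv (i, j)), by
      funext s
      exact congrArg b (finProdFinEquiv.apply_symm_apply s).symm⟩
  refine ⟨star Z * Z, star_mul_self_nonneg Z, ?_, fun r => ?_⟩
  · simpa [QFFormula.eval, Term.eval_sum, eval_gramTerm, Term.eval, choiMap_apply] using hb 0
  · simpa [QFFormula.eval, Term.eval_sum, eval_gramTerm, Term.eval, choiMap_apply] using hb r.succ

end CStarLogic

/-! ### The language of operator systems -/

namespace OpSysLogic

section

variable {A : Type u} [CStarAlgebra A] [PartialOrder A] [StarOrderedRing A]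
  {B : Type v} [CStarAlgebra B] [PartialOrder B] [StarOrderedRing B]

theorem exists_carrierNorm_le_zero (σ : Srt) : ∃ x : Carrier A σ, carrierNorm σ x ≤ 0 := by
  cases σ with
  | mat n => exact ⟨(0 : CStarMatrix (Fin n) (Fin n) A), norm_zero.le⟩
  | cone n => exact ⟨(⟨0, le_rfl⟩ : {X : CStarMatrix (Fin n) (Fin n) A // 0 ≤ X}), norm_zero.le⟩
  | scal m n => exact ⟨⟨0⟩, norm_zero.le⟩
  | nonneg => exact ⟨⟨0⟩, le_rfl⟩

/-- Along an existential embedding, a finite system of conditions `θ i ≤ c i` with parameters in `A`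
that has a solution in `B` has approximate solutions in `A`. -/
theorem IsExistential.exists_lt {f : A →⋆ₐ[ℂ] B} (hf : IsExistential f) {n p q : ℕ}
    {s : Fin p → Srt} {t : Fin q → Srt} (θ : Fin n → QFFormula (Sum.elim s t))
    (c : Fin n → ℝ) (a : (i : Fin p) → Carrier A (s i)) (b : (j : Fin q) → Carrier B (t j))
    (hb : ∀ i, (θ i).eval (A := B) (Sum.rec (fun i => carrierMap f _ (a i)) b) ≤ c i) {δ : ℝ}
    (hδ : 0 < δ) :
    ∃ b' : (j : Fin q) → Carrier A (t j), ∀ i, (θ i).eval (A := A) (Sum.rec a b') < c i + δ := by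
  obtain ⟨N, hN1, hN⟩ : ∃ N : ℕ, 1 ≤ N ∧ ∀ j, carrierNorm _ (b j) ≤ N := by
    obtain ⟨N, hN⟩ := exists_nat_ge (∑ j, |carrierNorm _ (b j)|)
    refine ⟨N + 1, by simp, fun j => ?_⟩
    have := Finset.single_le_sum (f := fun j => |carrierNorm _ (b j)|) (fun _ _ => abs_nonneg _)
      (Finset.mem_univ j)
    push_cast
    linarith [le_abs_self (carrierNorm _ (b j))]
  choose o ho using fun j => exists_carrierNorm_le_zero (A := A) (t j)
  obtain ⟨_, ⟨b', -, rfl⟩, h⟩ := exists_lt_of_sInf_eq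
    (hf.2 p q s t (.conn n (excess c) θ) N hN1 a)
    ⟨_, o, fun j => (ho j).trans N.cast_nonneg, rfl⟩
    (by rintro _ ⟨d, -, rfl⟩; exact excess_nonneg _ _)
    ⟨b, hN, (excess_eq_zero hb).symm⟩ hδ
  exact ⟨b', lt_add_of_excess_lt h⟩

/-- The sum of a finite family of terms of sort `M₁(S)`. -/
def Term.sum {V : Type} {s : V → Srt} : {n : ℕ} → (Fin n → Term s (.mat 1)) → Term s (.mat 1)
  | 0, _ => .zero
  | _ + 1, t => .add (t 0) (Term.sum fun i => t i.succ)

/-- The value of a term of sort `M₁(S)`, as an element of the algebra. -/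
def Term.val {V : Type} {s : V → Srt} (a : (x : V) → Carrier A (s x)) (X : Term s (.mat 1)) : A :=
  (X.eval a : CStarMatrix (Fin 1) (Fin 1) A) 0 0

theorem Term.val_sum {V : Type} {s : V → Srt} (a : (x : V) → Carrier A (s x)) {n : ℕ}
    (t : Fin n → Term s (.mat 1)) : (Term.sum t).val a = ∑ i, (t i).val a := by
  induction n with
  | zero => rfl
  | succ n ih =>
    rw [Fin.sum_univ_succ, ← ih]
    rfl

theorem norm_apply_zero_zero (X : CStarMatrix (Fin 1) (Fin 1) A) : ‖X 0 0‖ = ‖X‖ := by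
  let e : CStarMatrix (Fin 1) (Fin 1) A →⋆ₐ[ℂ] A :=
    { toFun := fun X => X 0 0
      map_one' := rfl
      map_mul' := fun X Y => by simp [CStarMatrix.mul_apply]
      map_zero' := rfl
      map_add' := fun X Y => rfl
      commutes' := fun r => rfl
      map_star' := fun X => rfl }
  refine NonUnitalStarAlgHom.norm_map e (fun X Y h => ?_) X
  ext i j
  rw [Subsingleton.elim i 0, Subsingleton.elim j 0]
  exact h

theorem eval_dist {V : Type} {s : V → Srt} (a : (x : V) → Carrier A (s x))
    (X Y : Term s (.mat 1)) : (QFFormula.dist X Y).eval a = ‖X.val a - Y.val a‖ :=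
  (norm_apply_zero_zero _).symm

/-- The sorts of the two parameters: a matrix over the algebra, whose diagonal holds the right-hand
sides of a linear system, and a scalar matrix, whose rows hold the coefficients. A pair of parameters
in place of two families makes all sorts reduce by definition. -/
abbrev paramSrt (p k : ℕ+) : Fin 2 → Srt
  | 0 => .mat p
  | 1 => .scal p (k * k)

/-- The sort of the quantified variable: the cone of positive `k × k` matrices. -/
abbrev coneSrt (k : ℕ+) : Fin 1 → Srt := fun _ => .cone k

/-- The assignment of the two parameters. -/
def param {p k : ℕ+} (X : CStarMatrix (Fin p) (Fin p) A)
    (Z : CStarMatrix (Fin p) (Fin (k * k : ℕ+)) ℂ) : (i : Fin 2) → Carrier A (paramSrt p k i)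
  | 0 => X
  | 1 => ⟨Z⟩

/-- The assignment of the two parameters and of the quantified variable. -/
def assign {p k : ℕ+} (X : CStarMatrix (Fin p) (Fin p) A)
    (Z : CStarMatrix (Fin p) (Fin (k * k : ℕ+)) ℂ)
    (C : {C : CStarMatrix (Fin k) (Fin k) A // 0 ≤ C}) :
    (x : Fin 2 ⊕ Fin 1) → Carrier A (Sum.elim (paramSrt p k) (coneSrt k) x) :=
  Sum.rec (param X Z) fun _ => C

/-- The `(i, j)` entry of the quantified positive matrix. -/
def coneEntry {p k : ℕ+} (i j : Fin k) : Term (Sum.elim (paramSrt p k) (coneSrt k)) (.mat 1) :=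
  .entry i j (.incl (.var (s := Sum.elim (paramSrt p k) (coneSrt k)) (Sum.inr 0)))

/-- The `r`-th diagonal entry of the matrix parameter. -/
def paramEntry {p k : ℕ+} (r : Fin p) : Term (Sum.elim (paramSrt p k) (coneSrt k)) (.mat 1) :=
  .entry r r (.var (s := Sum.elim (paramSrt p k) (coneSrt k)) (Sum.inl 0))

/-- The `(r, j)` entry of the scalar parameter. -/
def scalEntryTerm {p k : ℕ+} (r : Fin p) (j : Fin (k * k : ℕ+)) :
    Term (Sum.elim (paramSrt p k) (coneSrt k)) (.scal 1 1) :=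
  .scalEntry r j (.var (s := Sum.elim (paramSrt p k) (coneSrt k)) (Sum.inl 1))

theorem val_coneEntry {p k : ℕ+} (X : CStarMatrix (Fin p) (Fin p) A) (Z) (C) (i j : Fin k) :
    (coneEntry i j).val (assign X Z C) = C.1 i j := rfl

theorem val_paramEntry {p k : ℕ+} (X : CStarMatrix (Fin p) (Fin p) A) (Z)
    (C : {C : CStarMatrix (Fin k) (Fin k) A // 0 ≤ C}) (r : Fin p) :
    (paramEntry r).val (assign X Z C) = X r r := rfl

theorem val_smul {p k : ℕ+} (X : CStarMatrix (Fin p) (Fin p) A) (Z) (C) (r) (s) (i j : Fin k) :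
    (Term.smul (scalEntryTerm r s) (coneEntry i j)).val (assign X Z C) = Z r s • C.1 i j := rfl


theorem eval_norm {V : Type} {s : V → Srt} (a : (x : V) → Carrier A (s x))
    (X : Term s (.mat 1)) : (QFFormula.norm X).eval a = ‖X.val a‖ :=
  (norm_apply_zero_zero _).symm

/-- The norm of the trace of the quantified positive matrix. -/
def traceFormula {p k : ℕ+} : QFFormula (Sum.elim (paramSrt p k) (coneSrt k)) :=
  .norm (Term.sum fun i : Fin k => coneEntry i i)

theorem eval_traceFormula {p k : ℕ+} (X : CStarMatrix (Fin p) (Fin p) A) (Z)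
    (C : {C : CStarMatrix (Fin k) (Fin k) A // 0 ≤ C}) :
    traceFormula.eval (assign X Z C) = ‖∑ i, C.1 i i‖ := by
  rw [traceFormula, eval_norm, Term.val_sum]
  rfl

/-- The equivalence that lists the positions of a `k × k` matrix. -/
def pairIndex (k : ℕ+) : Fin k × Fin k ≃ Fin (k * k : ℕ+) :=
  finProdFinEquiv.trans (finCongr (PNat.mul_coe k k).symm)

/-- The distance between the two sides of the `r`-th equation of the linear system. -/
def distFormula {p k : ℕ+} (r : Fin p) : QFFormula (Sum.elim (paramSrt p k) (coneSrt k)) :=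
  .dist (Term.sum fun i : Fin k => Term.sum fun j : Fin k =>
    .smul (scalEntryTerm r (pairIndex k (i, j))) (coneEntry i j)) (paramEntry r)

open ChoiCorrespondence in
theorem eval_distFormula {p k : ℕ+} {X : CStarMatrix (Fin p) (Fin p) A}
    {Z : CStarMatrix (Fin p) (Fin (k * k : ℕ+)) ℂ}
    {C : {C : CStarMatrix (Fin k) (Fin k) A // 0 ≤ C}} {r : Fin p}
    {z : CStarMatrix (Fin k) (Fin k) ℂ} (hZ : ∀ i j, Z r (pairIndex k (i, j)) = z i j) :
    (distFormula r).eval (assign X Z C) = ‖choiMap C.1 z - X r r‖ := by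
  rw [distFormula, eval_dist, Term.val_sum, choiMap_apply, val_paramEntry]
  simp only [Term.val_sum, val_smul, hZ]

open ChoiCorrespondence in
/-- The matrix `C` is the quantified variable of the cone sort; the diagonal of `X` holds the elements
`a r`, and the rows of `Z` hold the scalar matrices `z r`. -/
theorem IsExistential.exists_nonneg_matrix {f : A →⋆ₐ[ℂ] B} (hf : IsExistential f) {p k : ℕ+}
    (a : Fin p → A) (z : Fin p → CStarMatrix (Fin k) (Fin k) ℂ) {ε : ℝ} (hε : 0 < ε)
    {C : CStarMatrix (Fin k) (Fin k) B} (hC : 0 ≤ C) (htr : ‖∑ i, C i i‖ ≤ 1)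
    (hCa : ∀ r, ‖choiMap C (z r) - f (a r)‖ ≤ ε) :
    ∃ C' : CStarMatrix (Fin k) (Fin k) A, 0 ≤ C' ∧ ‖∑ i, C' i i‖ < 1 + ε ∧
      ∀ r, ‖choiMap C' (z r) - a r‖ < ε + ε := by
  let X : CStarMatrix (Fin p) (Fin p) A := CStarMatrix.ofMatrix fun r _ => a r
  let Z : CStarMatrix (Fin p) (Fin (k * k : ℕ+)) ℂ := CStarMatrix.ofMatrix fun r s =>
    z r ((pairIndex k).symm s).1 ((pairIndex k).symm s).2
  have hZ (r : Fin p) (i j : Fin k) : Z r (pairIndex k (i, j)) = z r i j := by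
    change z r ((pairIndex k).symm (pairIndex k (i, j))).1 _ = _
    rw [Equiv.symm_apply_apply]
  have hB : (Sum.rec (fun i => carrierMap f _ (param X Z i)) fun _ => ⟨C, hC⟩ :
      (x : Fin 2 ⊕ Fin 1) → Carrier B (Sum.elim (paramSrt p k) (coneSrt k) x)) =
      assign (X.map f) Z ⟨C, hC⟩ := by
    funext x
    rcases x with x | x
    · fin_cases x <;> rfl
    · rfl
  obtain ⟨b, hb⟩ := hf.exists_lt (Fin.cons traceFormula fun r : Fin p => distFormula r)
    (Fin.cons 1 fun _ => ε) (param X Z) (fun _ => ⟨C, hC⟩)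
    (by
      rw [hB]
      refine Fin.cases ?_ fun r => ?_
      · rw [Fin.cons_zero, Fin.cons_zero, eval_traceFormula]
        exact htr
      · rw [Fin.cons_succ, Fin.cons_succ, eval_distFormula (hZ r)]
        exact hCa r) hε
  have hA : (Sum.rec (param X Z) b :
      (x : Fin 2 ⊕ Fin 1) → Carrier A (Sum.elim (paramSrt p k) (coneSrt k) x)) =
      assign X Z (b 0) := by
    funext x
    rcases x with x | x
    · rfl
    · rw [Subsingleton.elim x 0]
      rfl
  rw [hA] at hb
  refine ⟨(b 0).1, (b 0).2, ?_, fun r => ?_⟩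
  · have := hb 0
    rwa [Fin.cons_zero, Fin.cons_zero, eval_traceFormula] at this
  · have := hb r.succ
    rwa [Fin.cons_succ, Fin.cons_succ, eval_distFormula (hZ r)] at this

open ChoiCorrespondence in
theorem IsExistential.liftsPositiveMatrices {f : A →⋆ₐ[ℂ] B} (hf : IsExistential f) :
    LiftsPositiveMatrices f := by
  rintro p k a z ε hε ⟨C, hC, htr, hCa⟩
  rcases k with _ | k
  -- There is no sort of `0 × 0` matrices; here the system says that the `a r` are small, and `f` is
  -- isometric.
  · refine ⟨0, le_rfl, by simpa using by linarith, fun r => ?_⟩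
    have := hCa r
    simp only [choiMap_apply, Finset.univ_eq_empty, Finset.sum_empty, zero_sub, norm_neg,
      NonUnitalStarAlgHom.norm_map f hf.1] at this ⊢
    linarith
  · exact hf.exists_nonneg_matrix (p := ⟨p + 1, p.succ_pos⟩) (k := ⟨k + 1, k.succ_pos⟩) a z hε hC
      htr hCa

end

end OpSysLogic

/-! ### Nuclear existential embeddings -/

theorem mainTheorem3 :
    -- an existential nuclear embedding, in the language of unital C⋆-algebras
    (∀ (A : Type u) [CStarAlgebra A] [PartialOrder A] [StarOrderedRing A]
        (B : Type v) [CStarAlgebra B] [PartialOrder B] [StarOrderedRing B] (f : A →⋆ₐ[ℂ] B),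
        CStarLogic.IsExistential f → IsNuclearMap f → IsNuclearCStar A) ∧
    -- a nuclear embedding that is existential in the language of operator systems
    (∀ (A : Type u) [CStarAlgebra A] [PartialOrder A] [StarOrderedRing A]
        (B : Type v) [CStarAlgebra B] [PartialOrder B] [StarOrderedRing B] (f : A →⋆ₐ[ℂ] B),
        OpSysLogic.IsExistential f → IsNuclearMap f → IsNuclearCStar A) ∧
    -- exact existentially closed algebras
    (∀ (A : Type u) [CStarAlgebra A] [PartialOrder A] [StarOrderedRing A],
        IsExactCStar A → CStarLogic.IsExistentiallyClosed A → IsNuclearCStar A) := by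
  refine ⟨fun A _ _ _ B _ _ _ f hf hn => hf.liftsPositiveMatrices.isNuclearCStar hn,
    fun A _ _ _ B _ _ _ f hf hn => hf.liftsPositiveMatrices.isNuclearCStar hn, ?_⟩
  rintro A _ _ _ ⟨H, _, _, _, π, hπ, hn⟩ hA
  exact (hA _ π hπ).liftsPositiveMatrices.isNuclearCStar hn

end
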